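/- Let $K$ be a compact Hausdorff space such that $C(K;\mathbb{C})$ is order complete, i.e. every non-empty subset of $C(K;\mathbb{R})$ that is bounded above (for the pointwise order) has a supremum in $C(K;\mathbb{R})$. Let $T$ be a Markov operator on $C(K;\mathbb{C})$, i.e. a bounded linear operator with $Tf\ge 0$ whenever $f\ge 0$ and with $T\mathbb{1}=\mathbb{1}$, where $\mathbb{1}$ is the constant function with value $1$. Then $$\dim\ker(e^{i\theta}-T)\le\dim\ker(e^{in\theta}-T)\qquad\text{for every }\theta\in 2\pi\mathbb{Q}\text{ and every }n\in\mathbb{Z},$$ where dimensions take values in $\{0,1,2,\dots\}\cup\{\infty\}$ (different infinite cardinalities are not distinguished). In particular, the rational peripheral point spectrum of $T$, that is, the set $$\{r(T)e^{i\theta}:\theta\in2\pi\mathbb{Q}\}\cap\sigma_{\mathrm{pnt}}(T),$$ where $r(T)$ is the spectral radius and $\sigma_{\mathrm{pnt}}(T)$ the set of eigenvalues of $T$, is cyclic; here a set $M\subset\mathbb{C}$ is called cyclic if $re^{i\theta}\in M$ with $r\ge0$, $\theta\in\mathbb{R}$ implies $re^{in\theta}\in M$ for every $n\in\mathbb{Z}$.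 -/

import Mathlib

open scoped ComplexOrder

/-- Order completeness: every nonempty subset that is bounded above has a least upper bound. -/
def IsOrderComplete (α : Type*) [Preorder α] : Prop :=
  ∀ s : Set α, s.Nonempty → BddAbove s → ∃ a, IsLUB s a

/-- A Markov operator on `C(K;ℂ)`: a bounded linear operator that is positive and fixes the
constant function one. Here `0 ≤ f` in `C(K, ℂ)` is the pointwise order, and `0 ≤ z` for a complex
number `z` says that `z` is real and nonnegative. -/
structure IsMarkovOperator {K : Type*} [TopologicalSpace K] [CompactSpace K]
    (T : C(K, ℂ) →L[ℂ] C(K, ℂ)) : Prop where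
  nonneg : ∀ f : C(K, ℂ), 0 ≤ f → 0 ≤ T f
  map_one : T 1 = 1

section Spectral

variable {X : Type*} [NormedAddCommGroup X] [NormedSpace ℂ X]

/-- The subspace `ker (z - T)`. -/
noncomputable def kerSub (z : ℂ) (T : X →L[ℂ] X) : Submodule ℂ X :=
  LinearMap.ker ((z • ContinuousLinearMap.id ℂ X - T : X →L[ℂ] X) : X →ₗ[ℂ] X)

/-- The dimension of a complex vector space, as an element of `{0, 1, 2, …, ∞}`. -/
noncomputable def edim (V : Type*) [AddCommGroup V] [Module ℂ V] : ℕ∞ :=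
  Cardinal.toENat (Module.rank ℂ V)

/-- The point spectrum: the set of eigenvalues. -/
def pointSpectrum (T : X →L[ℂ] X) : Set ℂ :=
  {z | ∃ x : X, x ≠ 0 ∧ T x = z • x}

/-- The rational peripheral point spectrum: the eigenvalues of the form `r(T) e^{iθ}` with
`θ ∈ 2πℚ`, where `r(T)` is the spectral radius. -/
noncomputable def rationalPeripheralPointSpectrum (T : X →L[ℂ] X) : Set ℂ :=
  {z | ∃ q : ℚ, z = ((spectralRadius ℂ T).toReal : ℂ) *
    Complex.exp (Complex.I * ((2 * Real.pi * (q : ℝ) : ℝ) : ℂ))} ∩ pointSpectrum T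

end Spectral

/-- A set `M ⊆ ℂ` is cyclic if `r e^{iθ} ∈ M` implies `r e^{inθ} ∈ M` for all integers `n`. -/
def IsCyclicSet (M : Set ℂ) : Prop :=
  ∀ r θ : ℝ, 0 ≤ r → (r : ℂ) * Complex.exp (Complex.I * (θ : ℂ)) ∈ M →
    ∀ n : ℤ, (r : ℂ) * Complex.exp (Complex.I * (n : ℂ) * (θ : ℂ)) ∈ M

/-! Let z be a root of unity, z ^ (N + 1) = 1, and let F be the fixed space of T ^ (N + 1) in C(K,
ℝ). Real and imaginary parts of eigenfunctions for z and z ^ n lie in F. Order completeness gives F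
its own positive parts, so Kakutani's theorem identifies F with C(L, ℝ), L being the space of
lattice states. On F the operator T is an order isomorphism, hence becomes composition with a map Φ
of L. An eigenfunction for z is thus a function h with h ∘ Φ = z h, and |h| (h / |h|) ^ n is an
eigenfunction for z ^ n. This assignment is not linear, but it fixes the values 0 and 1: a family
that is a Kronecker delta at finitely many points of L stays one, so dimensions cannot drop. -/

/-- If `J : V → (X → ℂ)` and `J' : W → (X → ℂ)` are linear, `J` is injective and every `G ∘ J v`
with a fixed `G` satisfying `G 0 = 0`, `G 1 = 1` lies in the range of `J'`, then
`dim V ≤ dim W`. -/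
theorem edim_le_of_comp_mem {X V W : Type*} [AddCommGroup V] [Module ℂ V] [AddCommGroup W]
    [Module ℂ W] (J : V →ₗ[ℂ] (X → ℂ)) (J' : W →ₗ[ℂ] (X → ℂ)) (hJ : Function.Injective J)
    (G : ℂ → ℂ) (h0 : G 0 = 0) (h1 : G 1 = 1) (hG : ∀ v, ∃ w, J' w = G ∘ J v) :
    edim V ≤ edim W := by
  -- Testing against every finite m also covers infinite dimension.
  refine ENat.forall_natCast_le_iff_le.mp fun m hm => ?_
  unfold edim at hm ⊢
  rw [Cardinal.natCast_le_toENat] at hm ⊢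
  obtain ⟨f, hf⟩ := Module.le_rank_iff_exists_linearMap.mp hm
  let e : X → Module.Dual ℂ (Fin m → ℂ) := fun x => LinearMap.proj x ∘ₗ J ∘ₗ f
  -- Point evaluations separate vectors, so a maximal independent set of them is a basis of the
  -- dual, and its dual basis is a delta family.
  obtain ⟨b, hbe, hspan, hli⟩ := exists_linearIndependent ℂ (Set.range e)
  have : Finite b := hli.finite
  have := Fintype.ofFinite b
  let A : (Fin m → ℂ) →ₗ[ℂ] (b → ℂ) := LinearMap.pi fun β => (β : Module.Dual ℂ (Fin m → ℂ))
  have hA : Function.Injective A := by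
    rw [injective_iff_map_eq_zero]
    intro v hv
    have hle : Submodule.span ℂ b ≤ LinearMap.ker (Module.Dual.eval ℂ (Fin m → ℂ) v) :=
      Submodule.span_le.mpr fun β hβ => congrFun hv ⟨β, hβ⟩
    rw [hspan] at hle
    have hx : J (f v) = 0 := by
      funext x
      exact hle (Submodule.subset_span ⟨x, rfl⟩)
    exact (injective_iff_map_eq_zero f).mp hf _ ((injective_iff_map_eq_zero J).mp hJ _ hx)
  have hcard : m = Fintype.card b := by
    have hle := LinearMap.finrank_le_finrank_of_injective hA
    have hge := hli.fintype_card_le_finrank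
    rw [Subspace.dual_finrank_eq] at hge
    simp only [Module.finrank_fintype_fun_eq_card, Fintype.card_fin] at hle hge
    exact le_antisymm hle hge
  have hsurj : Function.Surjective A :=
    (LinearMap.injective_iff_surjective_of_finrank_eq_finrank (by simp [← hcard])).mp hA
  choose x hx using fun β : b => hbe β.2
  classical
  choose v hv using fun β : b => hsurj (Pi.single β 1)
  choose w hw using fun β : b => hG (f (v β))
  have hwx : ∀ β γ, J' (w β) (x γ) = if γ = β then 1 else 0 := by
    intro β γ
    have h : J (f (v β)) (x γ) = if γ = β then 1 else 0 := by
      have := congrFun (hv β) γ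
      rw [Pi.single_apply] at this
      rw [← this]
      change e (x γ) (v β) = _
      rw [hx]
      rfl
    rw [hw, Function.comp_apply, h]
    split_ifs <;> assumption
  have hwli : LinearIndependent ℂ w := by
    rw [Fintype.linearIndependent_iff]
    intro c hc γ
    have := congrFun (congrArg J' hc) (x γ)
    simpa [hwx] using this
  have := hwli.cardinal_lift_le_rank
  rw [Cardinal.mk_fintype, ← hcard] at this
  simpa using this

/-! ### Powers of the phase -/

/-- The map `z ↦ |z| (z / |z|) ^ n`. -/
noncomputable def phasePow (n : ℤ) (z : ℂ) : ℂ := ‖z‖ * (z / ‖z‖) ^ n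

theorem phasePow_zero (n : ℤ) : phasePow n 0 = 0 := by simp [phasePow]

theorem phasePow_one (n : ℤ) : phasePow n 1 = 1 := by simp [phasePow]

theorem phasePow_mul (n : ℤ) {c : ℂ} (hc : ‖c‖ = 1) (z : ℂ) :
    phasePow n (c * z) = c ^ n * phasePow n z := by
  simp only [phasePow, norm_mul, hc, one_mul, mul_div_assoc, mul_zpow]
  ring

theorem norm_phasePow (n : ℤ) (z : ℂ) : ‖phasePow n z‖ = ‖z‖ := by
  rcases eq_or_ne z 0 with rfl | hz
  · simp [phasePow_zero]
  · simp [phasePow, hz]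

theorem continuous_phasePow (n : ℤ) : Continuous (phasePow n) := by
  rw [continuous_iff_continuousAt]
  intro z
  rcases eq_or_ne z 0 with rfl | hz
  · rw [ContinuousAt, phasePow_zero, tendsto_zero_iff_norm_tendsto_zero]
    simp only [norm_phasePow]
    exact tendsto_norm_zero
  · have hn : (‖z‖ : ℂ) ≠ 0 := by simpa using hz
    unfold phasePow
    refine ContinuousAt.mul (by fun_prop) (ContinuousAt.zpow₀ ?_ n (Or.inl (div_ne_zero hz hn)))
    exact ContinuousAt.div (by fun_prop) (by fun_prop) hn

/-! ### Kakutani representation through lattice states -/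

section Kakutani

variable {K : Type*} [TopologicalSpace K]

/-- The states of an ordered subspace `F` of `C(K, ℝ)` with respect to an order unit `e`. -/
def stateSet (F : Submodule ℝ C(K, ℝ)) (e : F) : Set (F → ℝ) :=
  {φ | (∀ f g, φ (f + g) = φ f + φ g) ∧ (∀ (c : ℝ) f, φ (c • f) = c * φ f) ∧
    (∀ f, 0 ≤ f → 0 ≤ φ f) ∧ φ e = 1}

/-- The states that map the positive part, formed in `F`, to the positive part. -/
def latticeStateSet (F : Submodule ℝ C(K, ℝ)) (e : F) : Set (F → ℝ) :=
  {φ | φ ∈ stateSet F e ∧ ∀ f u, IsLeast {v | f ≤ v ∧ 0 ≤ v} u → φ u = max (φ f) 0}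

variable {F : Submodule ℝ C(K, ℝ)} {e : F}

/-- A state as a linear functional. -/
def stateLinearMap {φ : F → ℝ} (h : φ ∈ stateSet F e) : F →ₗ[ℝ] ℝ where
  toFun := φ
  map_add' := h.1
  map_smul' := h.2.1

theorem Submodule.smul_le_smul_of_le {c : ℝ} (hc : 0 ≤ c) {f g : F} (h : f ≤ g) :
    c • f ≤ c • g :=
  fun x => mul_le_mul_of_nonneg_left (h x) hc

theorem isClosed_stateSet : IsClosed (stateSet F e) := by
  simp only [stateSet, Set.ofPred_and, Set.ofPred_forall]
  refine IsClosed.inter ?_ (IsClosed.inter ?_ (IsClosed.inter ?_ ?_))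
  · exact isClosed_iInter fun f => isClosed_iInter fun g =>
      isClosed_eq (by fun_prop) (by fun_prop)
  · exact isClosed_iInter fun f => isClosed_iInter fun g =>
      isClosed_eq (by fun_prop) (by fun_prop)
  · exact isClosed_iInter fun f => isClosed_iInter fun g =>
      isClosed_le (by fun_prop) (by fun_prop)
  · exact isClosed_eq (by fun_prop) (by fun_prop)

theorem isClosed_latticeStateSet : IsClosed (latticeStateSet F e) := by
  simp only [latticeStateSet, Set.ofPred_and, Set.ofPred_forall]
  refine IsClosed.inter isClosed_stateSet ?_
  exact isClosed_iInter fun f => isClosed_iInter fun g => isClosed_iInter fun _ =>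
      isClosed_eq (by fun_prop) (by fun_prop)

theorem isLeast_posPart_smul {f u : F} (hu : IsLeast {v | f ≤ v ∧ 0 ≤ v} u) {c : ℝ} (hc : 0 < c) :
    IsLeast {v | c • f ≤ v ∧ 0 ≤ v} (c • u) := by
  have hsm : ∀ {a : ℝ} {v : F}, 0 ≤ a → 0 ≤ v → 0 ≤ a • v := fun ha hv => by
    simpa using Submodule.smul_le_smul_of_le ha hv
  refine ⟨⟨Submodule.smul_le_smul_of_le hc.le hu.1.1, hsm hc.le hu.1.2⟩, fun v hv => ?_⟩
  have : u ≤ c⁻¹ • v := hu.2 ⟨by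
    have := Submodule.smul_le_smul_of_le (inv_nonneg.mpr hc.le) hv.1
    rwa [inv_smul_smul₀ hc.ne'] at this, hsm (inv_nonneg.mpr hc.le) hv.2⟩
  have := Submodule.smul_le_smul_of_le hc.le this
  rwa [smul_inv_smul₀ hc.ne'] at this

/-- Evaluation of elements of `F` at the lattice states. -/
def latticeEval (F : Submodule ℝ C(K, ℝ)) (e : F) : F →ₗ[ℝ] C(latticeStateSet F e, ℝ) where
  toFun f := ⟨fun φ => φ.1 f, (continuous_apply f).comp continuous_subtype_val⟩
  map_add' f g := ContinuousMap.ext fun φ => φ.2.1.1 f g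
  map_smul' c f := ContinuousMap.ext fun φ => φ.2.1.2.1 c f

@[simp]
theorem latticeEval_apply (f : F) (φ : latticeStateSet F e) : latticeEval F e f φ = φ.1 f := rfl

variable [CompactSpace K]

theorem neg_norm_smul_le (he : (e : C(K, ℝ)) = 1) (f : F) : -(‖(f : C(K, ℝ))‖ • e) ≤ f := by
  intro x
  have h := (abs_le.mp ((f : C(K, ℝ)).norm_coe_le_norm x)).1
  change -(‖(f : C(K, ℝ))‖ * (e : C(K, ℝ)) x) ≤ _
  rwa [he, ContinuousMap.one_apply, mul_one]

theorem le_norm_smul (he : (e : C(K, ℝ)) = 1) (f : F) : f ≤ ‖(f : C(K, ℝ))‖ • e := by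
  intro x
  have h := (abs_le.mp ((f : C(K, ℝ)).norm_coe_le_norm x)).2
  change _ ≤ ‖(f : C(K, ℝ))‖ * (e : C(K, ℝ)) x
  rwa [he, ContinuousMap.one_apply, mul_one]

theorem abs_le_norm_mul (he : (e : C(K, ℝ)) = 1) (φ : F →ₗ[ℝ] ℝ)
    (hφ : ∀ f, 0 ≤ f → 0 ≤ φ f) (f : F) : |φ f| ≤ ‖(f : C(K, ℝ))‖ * φ e := by
  have h1 := hφ _ (sub_nonneg.mpr (le_norm_smul he f))
  have h2 := hφ _ (sub_nonneg.mpr (neg_norm_smul_le he f))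
  simp only [map_sub, map_neg, map_smul, smul_eq_mul] at h1 h2
  rw [abs_le]
  constructor <;> linarith

theorem abs_le_norm_of_mem_stateSet (he : (e : C(K, ℝ)) = 1) {φ : F → ℝ} (h : φ ∈ stateSet F e)
    (f : F) : |φ f| ≤ ‖(f : C(K, ℝ))‖ := by
  have := abs_le_norm_mul he (stateLinearMap h) h.2.2.1 f
  change |φ f| ≤ ‖(f : C(K, ℝ))‖ * φ e at this
  rwa [h.2.2.2, mul_one] at this

/-- Tychonoff: states take values in a product of the intervals [-‖f‖, ‖f‖]. -/
theorem isCompact_stateSet (he : (e : C(K, ℝ)) = 1) : IsCompact (stateSet F e) := by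
  refine (isCompact_univ_pi fun f : F => isCompact_Icc (a := -‖(f : C(K, ℝ))‖) (b := ‖(f : C(K, ℝ))‖)).of_isClosed_subset
    isClosed_stateSet fun φ hφ f _ => ?_
  exact abs_le.mp (abs_le_norm_of_mem_stateSet he hφ f)

theorem isCompact_latticeStateSet (he : (e : C(K, ℝ)) = 1) : IsCompact (latticeStateSet F e) :=
  (isCompact_stateSet he).of_isClosed_subset isClosed_latticeStateSet fun _ h => h.1

/-- A positive functional dominated by an extreme state is a multiple of it. -/
theorem eq_mul_of_le_extreme (he : (e : C(K, ℝ)) = 1) {φ : F → ℝ}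
    (hφ : φ ∈ (stateSet F e).extremePoints ℝ) (ψ : F →ₗ[ℝ] ℝ) (h0 : ∀ f, 0 ≤ f → 0 ≤ ψ f)
    (h1 : ∀ f, 0 ≤ f → ψ f ≤ φ f) (f : F) : ψ f = ψ e * φ f := by
  have hφs := hφ.1
  have hepos : 0 ≤ e := by
    intro x
    simp [he]
  have ht0 := h0 e hepos
  have ht1 := h1 e hepos
  rw [hφs.2.2.2] at ht1
  rcases ht0.eq_or_lt with ht | ht
  · have := abs_le_norm_mul he ψ h0 f
    rw [← ht, mul_zero] at this
    rw [← ht, zero_mul]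
    exact abs_nonpos_iff.mp this
  rcases ht1.eq_or_lt with ht' | ht'
  · have := abs_le_norm_mul he (stateLinearMap hφs - ψ) (fun g hg => sub_nonneg.mpr (h1 g hg)) f
    change |φ f - ψ f| ≤ ‖(f : C(K, ℝ))‖ * (φ e - ψ e) at this
    rw [hφs.2.2.2, ht', sub_self, mul_zero] at this
    rw [ht', one_mul]
    linarith [abs_nonpos_iff.mp this]
  set t := ψ e with htdef
  have h1t : 0 < 1 - t := by linarith
  -- φ is the convex combination, with weights t and 1 - t, of the normalizations of ψ and φ - ψ;
  -- extremality makes both equal to φ.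
  have ha : (fun g => t⁻¹ * ψ g) ∈ stateSet F e := by
    refine ⟨fun f g => ?_, fun c f => ?_, fun f hf => ?_, ?_⟩
    · simp only [map_add]; ring
    · simp only [map_smul, smul_eq_mul]; ring
    · exact mul_nonneg (inv_nonneg.mpr ht0) (h0 f hf)
    · exact inv_mul_cancel₀ ht.ne'
  have hb : (fun g => (1 - t)⁻¹ * (φ g - ψ g)) ∈ stateSet F e := by
    refine ⟨fun f g => ?_, fun c f => ?_, fun f hf => ?_, ?_⟩
    · simp only [map_add, hφs.1]; ring
    · simp only [map_smul, smul_eq_mul, hφs.2.1]; ring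
    · exact mul_nonneg (inv_nonneg.mpr h1t.le) (sub_nonneg.mpr (h1 f hf))
    · simp only [hφs.2.2.2]
      exact inv_mul_cancel₀ h1t.ne'
  have := hφ.2 ha hb ⟨t, 1 - t, ht, h1t, by ring, by
    funext g
    simp only [Pi.add_apply, Pi.smul_apply, smul_eq_mul]
    field_simp
    ring⟩
  rw [← congrFun this f]
  field_simp

/-- Extreme states of a subspace with positive parts are lattice homomorphisms. -/
theorem extremePoints_subset_latticeStateSet (he : (e : C(K, ℝ)) = 1)
    (hF : ∀ f : F, ∃ u, IsLeast {v | f ≤ v ∧ 0 ≤ v} u) :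
    (stateSet F e).extremePoints ℝ ⊆ latticeStateSet F e := by
  intro φ hφ
  refine ⟨hφ.1, fun f u hu => ?_⟩
  choose P hP using hF
  have hφm : ∀ {a b : F}, a ≤ b → φ a ≤ φ b := fun {a b} hab => by
    have := hφ.1.2.2.1 _ (sub_nonneg.mpr hab)
    have h := hφ.1.1 (b - a) a
    rw [sub_add_cancel] at h
    linarith
  have hφ0 : φ 0 = 0 := by
    have := hφ.1.2.1 0 0
    simpa using this
  rw [hu.unique (hP f)]
  have hPpos : ∀ f, 0 ≤ φ (P f) := fun f => hφ.1.2.2.1 _ (hP f).1.2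
  rcases eq_or_ne f 0 with rfl | hf
  · have : P 0 = 0 := (hP 0).unique ⟨⟨le_rfl, le_rfl⟩, fun v hv => hv.2⟩
    simp [this, hφ0]
  have hPsmul : ∀ c : ℝ, 0 < c → ∀ g, φ (P (c • g)) = c * φ (P g) := fun c hc g => by
    rw [(hP (c • g)).unique (isLeast_posPart_smul (hP g) hc), hφ.1.2.1]
  -- Hahn–Banach with the sublinear bound g ↦ φ (g⁺) yields ψ with ψ f = φ (f⁺) and 0 ≤ ψ ≤ φ on the
  -- positive cone. Then ψ = t φ with t ∈ [0, 1], so φ (f⁺) = t φ f ≤ max (φ f) 0.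
  obtain ⟨ψ, hψf, hψ⟩ := exists_extension_of_le_sublinear
    (LinearPMap.mkSpanSingleton f (φ (P f)) hf : F →ₗ.[ℝ] ℝ) (fun g => φ (P g)) hPsmul
    (fun a b => by
      rw [← hφ.1.1]
      exact hφm ((hP _).2 ⟨add_le_add (hP a).1.1 (hP b).1.1, add_nonneg (hP a).1.2 (hP b).1.2⟩))
    (by
      rintro ⟨g, hg⟩
      obtain ⟨c, rfl⟩ := Submodule.mem_span_singleton.mp hg
      rw [LinearPMap.mkSpanSingleton'_apply]
      simp only [RingHom.id_apply, smul_eq_mul]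
      rcases lt_or_ge 0 c with hc | hc
      · exact (hPsmul c hc f).ge
      · exact (mul_nonpos_of_nonpos_of_nonneg hc (hPpos f)).trans (hPpos _))
  have hψf' : ψ f = φ (P f) := by
    have := hψf ⟨f, Submodule.mem_span_singleton_self f⟩
    rw [this]
    exact LinearPMap.mkSpanSingleton_apply _ _ hf _
  have hle : ∀ g, 0 ≤ g → ψ g ≤ φ g := fun g hg => by
    have : P g = g := (hP g).unique ⟨⟨le_rfl, hg⟩, fun v hv => hv.1⟩
    simpa [this] using hψ g
  have hnn : ∀ g, 0 ≤ g → 0 ≤ ψ g := fun g hg => by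
    have h : P (-g) = 0 :=
      (hP (-g)).unique ⟨⟨neg_nonpos.mpr hg, le_rfl⟩, fun v hv => hv.2⟩
    have := hψ (-g)
    rw [h, hφ0, map_neg] at this
    linarith
  have hepos : 0 ≤ e := by
    intro x
    simp [he]
  have ht0 := hnn e hepos
  have ht1 := hle e hepos
  rw [hφ.1.2.2.2] at ht1
  have key := eq_mul_of_le_extreme he hφ ψ hnn hle f
  rw [hψf'] at key
  refine le_antisymm ?_ (max_le (hφm (hP f).1.1) (hPpos f))
  rw [key]
  rcases le_total 0 (φ f) with h | h
  · exact (mul_le_of_le_one_left h ht1).trans (le_max_left _ _)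
  · exact (mul_nonpos_of_nonneg_of_nonpos ht0 h).trans (le_max_right _ _)

/-- States attaining the maximum of f form a compact extreme subset, nonempty since it contains
evaluation at x. Krein–Milman provides an extreme point of it, which is an extreme state. -/
theorem exists_mem_latticeStateSet_eq (he : (e : C(K, ℝ)) = 1)
    (hF : ∀ f : F, ∃ u, IsLeast {v | f ≤ v ∧ 0 ≤ v} u) (f : F) (x : K)
    (hx : ∀ y, (f : C(K, ℝ)) y ≤ (f : C(K, ℝ)) x) :
    ∃ φ ∈ latticeStateSet F e, φ f = (f : C(K, ℝ)) x := by
  set M := (f : C(K, ℝ)) x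
  have hle : ∀ φ ∈ stateSet F e, φ f ≤ M := fun φ hφ => by
    have := hφ.2.2.1 (M • e - f) (fun y => by simpa [he] using hx y)
    have h := hφ.1 (M • e - f) f
    rw [sub_add_cancel, hφ.2.1, hφ.2.2.2] at h
    linarith
  have hext : IsExtreme ℝ (stateSet F e) (stateSet F e ∩ {φ | φ f = M}) := by
    refine ⟨Set.inter_subset_left, fun φ hφ ψ hψ χ hχ hseg => ⟨hφ, ?_⟩⟩
    obtain ⟨a, b, ha, hb, hab, rfl⟩ := hseg
    have h1 : a * φ f + b * ψ f = M := hχ.2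
    refine le_antisymm (hle φ hφ) ?_
    have h2 : b * ψ f ≤ b * M := mul_le_mul_of_nonneg_left (hle ψ hψ) hb.le
    refine le_of_mul_le_mul_left ?_ ha
    have : a * M + b * M = M := by rw [← add_mul, hab, one_mul]
    linarith
  have hcomp : IsCompact (stateSet F e ∩ {φ | φ f = M}) :=
    (isCompact_stateSet he).inter_right (isClosed_eq (by fun_prop) (by fun_prop))
  obtain ⟨φ, hφ⟩ := hcomp.extremePoints_nonempty ⟨fun g => (g : C(K, ℝ)) x,
    ⟨fun _ _ => rfl, fun _ _ => rfl, fun g hg => hg x, by simp [he]⟩, rfl⟩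
  exact ⟨φ, extremePoints_subset_latticeStateSet he hF
    (hext.extremePoints_subset_extremePoints hφ), hφ.1.2⟩

theorem norm_le_of_latticeEval_le (he : (e : C(K, ℝ)) = 1)
    (hF : ∀ f : F, ∃ u, IsLeast {v | f ≤ v ∧ 0 ≤ v} u) (f : F) {C : ℝ} (hC : 0 ≤ C)
    (h : ∀ φ, |latticeEval F e f φ| ≤ C) : ‖(f : C(K, ℝ))‖ ≤ C := by
  rw [ContinuousMap.norm_le _ hC]
  have key : ∀ g : F, (∀ φ, latticeEval F e g φ ≤ C) → ∀ y, (g : C(K, ℝ)) y ≤ C := fun g hg y => by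
    have : Nonempty K := ⟨y⟩
    obtain ⟨x, -, hx⟩ := isCompact_univ.exists_isMaxOn Set.univ_nonempty
      (g : C(K, ℝ)).continuous.continuousOn
    obtain ⟨φ, hφ, hφx⟩ := exists_mem_latticeStateSet_eq he hF g x fun y => hx (Set.mem_univ y)
    exact (hx (Set.mem_univ y)).trans (hφx ▸ hg ⟨φ, hφ⟩)
  intro y
  rw [Real.norm_eq_abs, abs_le']
  refine ⟨key f (fun φ => (le_abs_self _).trans (h φ)) y, ?_⟩
  refine key (-f) (fun φ => ?_) y
  rw [map_neg]
  exact (neg_le_abs _).trans (h φ)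

theorem latticeEval_injective (he : (e : C(K, ℝ)) = 1)
    (hF : ∀ f : F, ∃ u, IsLeast {v | f ≤ v ∧ 0 ≤ v} u) :
    Function.Injective (latticeEval F e) := by
  rw [injective_iff_map_eq_zero]
  intro f hf
  have := norm_le_of_latticeEval_le he hF f le_rfl fun φ => by simp [hf]
  exact Subtype.ext (norm_le_zero_iff.mp this)

/-- **Kakutani's representation theorem** for closed subspaces of `C(K, ℝ)` that contain the
constants and have positive parts. -/
theorem latticeEval_surjective (he : (e : C(K, ℝ)) = 1)
    (hF : ∀ f : F, ∃ u, IsLeast {v | f ≤ v ∧ 0 ≤ v} u) (hcl : IsClosed (F : Set C(K, ℝ))) :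
    Function.Surjective (latticeEval F e) := by
  have hcpt : CompactSpace (latticeStateSet F e) :=
    isCompact_iff_compactSpace.mp (isCompact_latticeStateSet he)
  have : CompleteSpace F := hcl.completeSpace_coe
  -- Evaluation is isometric on a complete space, so its range is closed; the lattice form of
  -- Stone–Weierstrass makes it dense.
  have hanti : AntilipschitzWith 1 (latticeEval F e) :=
    AddMonoidHomClass.antilipschitz_of_bound _ fun f => by
      rw [NNReal.coe_one, one_mul]
      exact norm_le_of_latticeEval_le he hF f (norm_nonneg _) fun φ =>
        (latticeEval F e f).norm_coe_le_norm φ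
  have hlip : LipschitzWith 1 (latticeEval F e) :=
    AddMonoidHomClass.lipschitz_of_bound_nnnorm _ 1 fun f => by
      rw [one_mul, ← NNReal.coe_le_coe, coe_nnnorm, coe_nnnorm,
        ContinuousMap.norm_le _ (norm_nonneg _)]
      exact fun φ => abs_le_norm_of_mem_stateSet he φ.2.1 f
  have hclosed := hanti.isClosed_range hlip.uniformContinuous
  have hpos : ∀ f u : F, IsLeast {v | f ≤ v ∧ 0 ≤ v} u → ∀ φ : latticeStateSet F e,
    latticeEval F e u φ = max (latticeEval F e f φ) 0 := fun f u hu φ => φ.2.2 f u hu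
  rw [← Set.range_eq_univ, ← hclosed.closure_eq]
  refine ContinuousMap.sublattice_closure_eq_top _ ⟨_, 0, rfl⟩ ?_ ?_ ?_
  · rintro _ ⟨f, rfl⟩ _ ⟨g, rfl⟩
    obtain ⟨u, hu⟩ := hF (f - g)
    -- f ⊓ g = f - (f - g)⁺, and below f ⊔ g = g + (f - g)⁺.
    refine ⟨f - u, ContinuousMap.ext fun φ => ?_⟩
    rw [map_sub, ContinuousMap.sub_apply, hpos _ _ hu φ, map_sub, ContinuousMap.sub_apply,
      ContinuousMap.inf_apply]
    rcases le_total (latticeEval F e f φ) (latticeEval F e g φ) with h | h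
    · rw [max_eq_right (sub_nonpos.mpr h), inf_eq_left.mpr h, sub_zero]
    · rw [max_eq_left (sub_nonneg.mpr h), inf_eq_right.mpr h, sub_sub_cancel]
  · rintro _ ⟨f, rfl⟩ _ ⟨g, rfl⟩
    obtain ⟨u, hu⟩ := hF (f - g)
    refine ⟨g + u, ContinuousMap.ext fun φ => ?_⟩
    rw [map_add, ContinuousMap.add_apply, hpos _ _ hu φ, map_sub, ContinuousMap.sub_apply,
      ContinuousMap.sup_apply]
    rcases le_total (latticeEval F e f φ) (latticeEval F e g φ) with h | h
    · rw [max_eq_right (sub_nonpos.mpr h), sup_eq_right.mpr h, add_zero]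
    · rw [max_eq_left (sub_nonneg.mpr h), sup_eq_left.mpr h, add_sub_cancel]
  · intro v φ ψ
    have hone : ∀ χ : latticeStateSet F e, latticeEval F e e χ = 1 := fun χ => χ.2.1.2.2.2
    by_cases hφψ : φ = ψ
    · subst hφψ
      exact ⟨_, ⟨v φ • e, rfl⟩, by simp [hone, -latticeEval_apply], by
        simp [hone, -latticeEval_apply]⟩
    · obtain ⟨f, hf⟩ : ∃ f, latticeEval F e f φ ≠ latticeEval F e f ψ := by
        by_contra! h
        exact hφψ (Subtype.ext (funext h))
      have hd := sub_ne_zero.mpr hf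
      set a := latticeEval F e f φ with ha
      set b := latticeEval F e f ψ with hb
      refine ⟨_, ⟨((v φ - v ψ) / (a - b)) • f + ((v ψ * a - v φ * b) / (a - b)) • e, rfl⟩, ?_, ?_⟩
      · rw [map_add, map_smul, map_smul, ContinuousMap.add_apply, ContinuousMap.smul_apply,
          ContinuousMap.smul_apply, hone, ← ha, smul_eq_mul, smul_eq_mul]
        field_simp
        ring
      · rw [map_add, map_smul, map_smul, ContinuousMap.add_apply, ContinuousMap.smul_apply,
          ContinuousMap.smul_apply, hone, ← hb, smul_eq_mul, smul_eq_mul]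
        field_simp
        ring

end Kakutani

/-! ### Markov operators and their periodic parts -/

section Markov

variable {K : Type*} [TopologicalSpace K]

/-- The real part of a complex function. -/
noncomputable def reFun (K : Type*) [TopologicalSpace K] : C(K, ℂ) →L[ℝ] C(K, ℝ) :=
  Complex.reCLM.compLeftContinuous ℝ K

/-- The imaginary part of a complex function. -/
noncomputable def imFun (K : Type*) [TopologicalSpace K] : C(K, ℂ) →L[ℝ] C(K, ℝ) :=
  Complex.imCLM.compLeftContinuous ℝ K

/-- A real function as a complex function. -/
noncomputable def complexify (K : Type*) [TopologicalSpace K] : C(K, ℝ) →L[ℝ] C(K, ℂ) :=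
  Complex.ofRealCLM.compLeftContinuous ℝ K

@[simp]
theorem reFun_apply (f : C(K, ℂ)) (x : K) :
    reFun K f x = (f x).re := rfl

@[simp]
theorem imFun_apply (f : C(K, ℂ)) (x : K) :
    imFun K f x = (f x).im := rfl

@[simp]
theorem complexify_apply (f : C(K, ℝ)) (x : K) :
    complexify K f x = f x := rfl

/-- R is an order isomorphism, because its inverse R ^ N is monotone too. -/
theorem isLeast_posPart_map {F : Submodule ℝ C(K, ℝ)} {R : F →ₗ[ℝ] F} (hR : Monotone R) {N : ℕ}
    (hRN : ∀ f, R^[N + 1] f = f) {f u : F} (hu : IsLeast {v | f ≤ v ∧ 0 ≤ v} u) :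
    IsLeast {v | R f ≤ v ∧ 0 ≤ v} (R u) := by
  have h0 : R 0 = 0 := map_zero R
  have hinv : ∀ g, R (R^[N] g) = g := fun g => by
    rw [← Function.iterate_succ_apply' R, hRN]
  have hinv' : ∀ g, R^[N] (R g) = g := fun g => by
    rw [← Function.iterate_succ_apply R, hRN]
  refine ⟨⟨hR hu.1.1, h0 ▸ hR hu.1.2⟩, fun v hv => ?_⟩
  rw [← hinv v]
  refine hR (hu.2 ⟨?_, ?_⟩)
  · rw [← hinv' f]
    exact hR.iterate N hv.1
  · have := hR.iterate N hv.2
    rwa [Function.iterate_fixed h0] at this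

theorem comp_mem_latticeStateSet {F : Submodule ℝ C(K, ℝ)} {e : F} {R : F →ₗ[ℝ] F}
    (hR : Monotone R) (hRe : R e = e) {N : ℕ} (hRN : ∀ f, R^[N + 1] f = f) {φ : F → ℝ}
    (hφ : φ ∈ latticeStateSet F e) : (fun f => φ (R f)) ∈ latticeStateSet F e := by
  refine ⟨⟨fun f g => ?_, fun c f => ?_, fun f hf => ?_, ?_⟩, fun f u hu => ?_⟩
  · simp only [map_add, hφ.1.1]
  · simp only [map_smul, hφ.1.2.1]
  · exact hφ.1.2.2.1 _ (by simpa using hR hf)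
  · simp only [hRe, hφ.1.2.2.2]
  · exact hφ.2 _ _ (isLeast_posPart_map hR hRN hu)

variable [CompactSpace K]

/-- A positive unital operator on an order complete `C(K, ℝ)` has a fixed space with positive
parts. -/
theorem exists_isLeast_fixed (hK : IsOrderComplete C(K, ℝ)) (S : C(K, ℝ) →ₗ[ℝ] C(K, ℝ))
    (hS : Monotone S) (hS1 : S 1 = 1) {f : C(K, ℝ)} (hf : S f = f) :
    ∃ u, S u = u ∧ f ≤ u ∧ 0 ≤ u ∧ ∀ v, S v = v → f ≤ v → 0 ≤ v → u ≤ v := by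
  -- Knaster–Tarski: the infimum of the supersolutions above f and 0 is itself one, and so is its
  -- image under S, hence it is fixed. It is obtained as the supremum of the lower bounds.
  let A : Set C(K, ℝ) := {g | f ≤ g ∧ 0 ≤ g ∧ S g ≤ g}
  have hne : (‖f‖ • (1 : C(K, ℝ))) ∈ A := by
    refine ⟨fun x => ?_, fun x => ?_, ?_⟩
    · simpa using (le_abs_self _).trans (f.norm_coe_le_norm x)
    · simp
    · rw [map_smul, hS1]
  obtain ⟨a, ha⟩ := hK (lowerBounds A) ⟨f, fun g hg => hg.1⟩ ⟨_, fun g hg => hg hne⟩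
  have hglb : IsGLB A a := isLUB_lowerBounds.mp ha
  have hfa : f ≤ a := hglb.2 fun g hg => hg.1
  have h0a : 0 ≤ a := hglb.2 fun g hg => hg.2.1
  have hSa : S a ≤ a := hglb.2 fun g hg => (hS (hglb.1 hg)).trans hg.2.2
  refine ⟨a, le_antisymm hSa (hglb.1 ⟨?_, ?_, hS hSa⟩), hfa, h0a,
    fun v hv hfv h0v => hglb.1 ⟨hfv, h0v, hv.le⟩⟩
  · exact hf ▸ hS hfa
  · simpa using hS h0a

/-- The restriction of an operator on `C(K, ℂ)` to the real functions. -/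
noncomputable def realOp (T : C(K, ℂ) →L[ℂ] C(K, ℂ)) : C(K, ℝ) →L[ℝ] C(K, ℝ) :=
  reFun K ∘L T.restrictScalars ℝ ∘L complexify K

namespace IsMarkovOperator

variable {T : C(K, ℂ) →L[ℂ] C(K, ℂ)}

/-- Positivity makes T real on nonnegative functions, and a real function becomes nonnegative after
adding the constant ‖a‖. -/
theorem complexify_realOp (hT : IsMarkovOperator T) (a : C(K, ℝ)) :
    complexify K (realOp T a) = T (complexify K a) := by
  have hreal : ∀ b : C(K, ℝ), 0 ≤ b → imFun K (T (complexify K b)) = 0 := fun b hb => by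
    have h := hT.nonneg (complexify K b) fun x => by
      simpa using Complex.zero_le_real.mpr (hb x)
    exact ContinuousMap.ext fun x => (Complex.nonneg_iff.mp (h x)).2.symm
  have him : imFun K (T (complexify K a)) = 0 := by
    have h1 := hreal (a + ‖a‖ • 1) fun x => by
      have := (abs_le.mp (a.norm_coe_le_norm x)).1
      change 0 ≤ a x + ‖a‖ * 1
      linarith
    have h2 := hreal (‖a‖ • 1) fun x => by simp
    rw [map_add, map_add, map_add, h2, add_zero] at h1
    exact h1
  refine ContinuousMap.ext fun x => Complex.ext rfl ?_
  exact (congrArg (fun g : C(K, ℝ) => g x) him).symm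

theorem realOp_monotone (hT : IsMarkovOperator T) : Monotone (realOp T) := by
  intro a b hab
  have h := hT.nonneg (complexify K (b - a)) fun x => by
    simpa using Complex.real_le_real.mpr (hab x)
  intro x
  rw [map_sub, map_sub] at h
  have h' : 0 ≤ realOp T b x - realOp T a x := (Complex.nonneg_iff.mp (h x)).1
  exact sub_nonneg.mp h'

theorem realOp_one (hT : IsMarkovOperator T) : realOp T 1 = 1 := by
  have h : complexify K 1 = 1 := ContinuousMap.ext fun x => by simp
  have h' : reFun K 1 = 1 := ContinuousMap.ext fun x => by simp
  simp [realOp, h, hT.map_one, h']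

theorem reFun_map (hT : IsMarkovOperator T) (f : C(K, ℂ)) :
    reFun K (T f) = realOp T (reFun K f) ∧ imFun K (T f) = realOp T (imFun K f) := by
  have hf : f = complexify K (reFun K f) + Complex.I • complexify K (imFun K f) :=
    ContinuousMap.ext fun x => by
      simpa [mul_comm] using (Complex.re_add_im (f x)).symm
  have h : T f = complexify K (realOp T (reFun K f)) +
      Complex.I • complexify K (realOp T (imFun K f)) := by
    rw [hT.complexify_realOp, hT.complexify_realOp, ← map_smul, ← map_add, ← hf]
  constructor <;> refine ContinuousMap.ext fun x => ?_
  · rw [reFun_apply, h]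
    simp
  · rw [imFun_apply, h]
    simp

theorem norm_le_one (hT : IsMarkovOperator T) : ‖T‖ ≤ 1 := by
  refine T.opNorm_le_bound zero_le_one fun f => ?_
  rw [one_mul, ContinuousMap.norm_le _ (norm_nonneg _)]
  intro x
  -- Rotating f by c reduces the bound at x to the real operator applied to Re (c f) ≤ ‖f‖.
  obtain ⟨c, hc, hcx⟩ := Complex.exists_norm_eq_mul_self (T f x)
  have h1 : ‖T f x‖ = reFun K (T (c • f)) x := by
    rw [reFun_apply, map_smul, ContinuousMap.smul_apply, smul_eq_mul, ← hcx, Complex.ofReal_re]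
  rw [h1, (hT.reFun_map _).1]
  have h2 : reFun K (c • f) ≤ ‖f‖ • 1 := fun y => by
    have : ‖c * f y‖ ≤ ‖f‖ := by
      rw [norm_mul, hc, one_mul]
      exact f.norm_coe_le_norm y
    simpa using (Complex.re_le_norm _).trans this
  have h3 := hT.realOp_monotone h2
  rw [map_smul (realOp T) ‖f‖, hT.realOp_one] at h3
  simpa using h3 x

theorem iterate_realOp (hT : IsMarkovOperator T) {z : ℂ} {f : C(K, ℂ)} (hf : T f = z • f) (N : ℕ) :
    (realOp T)^[N] (reFun K f) = reFun K (z ^ N • f) ∧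
      (realOp T)^[N] (imFun K f) = imFun K (z ^ N • f) := by
  induction N with
  | zero => simp
  | succ N ih =>
    have h : T (z ^ N • f) = z ^ (N + 1) • f := by rw [map_smul, hf, smul_smul, pow_succ]
    rw [Function.iterate_succ_apply', Function.iterate_succ_apply', ih.1, ih.2, ← h,
      (hT.reFun_map _).1, (hT.reFun_map _).2]
    exact ⟨rfl, rfl⟩

end IsMarkovOperator

theorem mem_kerSub {X : Type*} [NormedAddCommGroup X] [NormedSpace ℂ X] {z : ℂ} {T : X →L[ℂ] X}
    {x : X} : x ∈ kerSub z T ↔ T x = z • x := by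
  change z • x - T x = 0 ↔ _
  rw [sub_eq_zero, eq_comm]

/-- Complex evaluation of functions with real and imaginary part in `F` at points of `L`. -/
noncomputable def complexEval {L : Type*} {F : Submodule ℝ C(K, ℝ)} (ev : F →ₗ[ℝ] (L → ℝ))
    (V : Submodule ℂ C(K, ℂ)) (hr : ∀ f ∈ V, reFun K f ∈ F) (hi : ∀ f ∈ V, imFun K f ∈ F) :
    V →ₗ[ℂ] (L → ℂ) where
  toFun f φ := ⟨ev ⟨_, hr f f.2⟩ φ, ev ⟨_, hi f f.2⟩ φ⟩
  map_add' f g := by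
    have h1 : (⟨_, hr _ (f + g).2⟩ : F) = ⟨_, hr f f.2⟩ + ⟨_, hr g g.2⟩ :=
      Subtype.ext (map_add (reFun K) _ _)
    have h2 : (⟨_, hi _ (f + g).2⟩ : F) = ⟨_, hi f f.2⟩ + ⟨_, hi g g.2⟩ :=
      Subtype.ext (map_add (imFun K) _ _)
    rw [h1, h2, map_add, map_add]
    rfl
  map_smul' c f := by
    have h1 : (⟨_, hr _ (c • f).2⟩ : F) = c.re • ⟨_, hr f f.2⟩ - c.im • ⟨_, hi f f.2⟩ :=
      Subtype.ext (ContinuousMap.ext fun x => Complex.mul_re _ _)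
    have h2 : (⟨_, hi _ (c • f).2⟩ : F) = c.re • ⟨_, hi f f.2⟩ + c.im • ⟨_, hr f f.2⟩ :=
      Subtype.ext (ContinuousMap.ext fun x => Complex.mul_im _ _)
    rw [h1, h2, map_add, map_sub, map_smul, map_smul, map_smul, map_smul]
    funext φ
    exact Complex.ext (by simp) (by simp)

theorem IsMarkovOperator.edim_kerSub_le (hK : IsOrderComplete C(K, ℝ))
    {T : C(K, ℂ) →L[ℂ] C(K, ℂ)} (hT : IsMarkovOperator T) {z : ℂ} {N : ℕ} (hz : z ^ (N + 1) = 1)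
    (n : ℤ) : edim (kerSub z T) ≤ edim (kerSub (z ^ n) T) := by
  let S : C(K, ℝ) →L[ℝ] C(K, ℝ) := realOp T ^ (N + 1)
  have hS : ∀ f, S f = (realOp T)^[N + 1] f := fun f => by
    simp only [S, FunLike.coe_pow_eq_iterate]
  let F : Submodule ℝ C(K, ℝ) := LinearMap.eqLocus (S : C(K, ℝ) →ₗ[ℝ] C(K, ℝ)) LinearMap.id
  have hmem : ∀ f, f ∈ F ↔ (realOp T)^[N + 1] f = f := fun f => by
    rw [← hS]
    rfl
  have hSmono : Monotone S := by
    rw [show (S : C(K, ℝ) → C(K, ℝ)) = (realOp T)^[N + 1] from funext hS]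
    exact hT.realOp_monotone.iterate _
  have hS1 : S 1 = 1 := by
    rw [hS, Function.iterate_fixed hT.realOp_one]
  let e : F := ⟨1, hS1⟩
  have he : (e : C(K, ℝ)) = 1 := rfl
  have hcl : IsClosed (F : Set C(K, ℝ)) := isClosed_eq S.continuous continuous_id
  have hF : ∀ f : F, ∃ u, IsLeast {v | f ≤ v ∧ 0 ≤ v} u := fun f => by
    obtain ⟨u, hu, hfu, h0u, hl⟩ := exists_isLeast_fixed hK (S : C(K, ℝ) →ₗ[ℝ] C(K, ℝ)) hSmono
      hS1 f.2
    exact ⟨⟨u, hu⟩, ⟨hfu, h0u⟩, fun v hv => hl v v.2 hv.1 hv.2⟩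
  have hmaps : ∀ f ∈ F, realOp T f ∈ F := fun f hf => by
    rw [hmem] at hf ⊢
    rw [← Function.iterate_succ_apply, Function.iterate_succ_apply', hf]
  let R : F →ₗ[ℝ] F := (realOp T : C(K, ℝ) →ₗ[ℝ] C(K, ℝ)).restrict hmaps
  have hRcoe : ∀ f : F, (R f : C(K, ℝ)) = realOp T f := fun f => rfl
  have hRmono : Monotone R := fun f g hfg => hT.realOp_monotone hfg
  have hRe : R e = e := Subtype.ext hT.realOp_one
  have hRN : ∀ f, R^[N + 1] f = f := fun f => by
    have h : ∀ m : ℕ, (R^[m] f : C(K, ℝ)) = (realOp T)^[m] f := fun m => by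
      induction m with
      | zero => rfl
      | succ m ih => rw [Function.iterate_succ_apply', Function.iterate_succ_apply', hRcoe, ih]
    exact Subtype.ext ((h _).trans ((hmem f).mp f.2))
  -- Composition with R preserves lattice states, so R is a composition operator on the representing
  -- space.
  let Φ : latticeStateSet F e → latticeStateSet F e := fun φ =>
    ⟨_, comp_mem_latticeStateSet hRmono hRe hRN φ.2⟩
  let ev : F →ₗ[ℝ] (latticeStateSet F e → ℝ) :=
    { toFun := fun f φ => latticeEval F e f φ
      map_add' := fun f g => by
        rw [map_add]
        rfl
      map_smul' := fun c f => by
        rw [map_smul]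
        rfl }
  have hevinj : ∀ f g, ev f = ev g → f = g := fun f g h =>
    latticeEval_injective he hF (ContinuousMap.ext fun φ => congrFun h φ)
  have hevR : ∀ f φ, ev (R f) φ = ev f (Φ φ) := fun f φ => rfl
  have hker : ∀ w : ℂ, w ^ (N + 1) = 1 → ∀ f ∈ kerSub w T, reFun K f ∈ F ∧ imFun K f ∈ F :=
    fun w hw f hf => by
      have := hT.iterate_realOp (mem_kerSub.mp hf) (N + 1)
      rw [hw, one_smul] at this
      exact ⟨(hmem _).mpr this.1, (hmem _).mpr this.2⟩
  have hzn : (z ^ n) ^ (N + 1) = 1 := by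
    rw [← zpow_natCast, zpow_comm, zpow_natCast, hz, one_zpow]
  have hnorm : ‖z‖ = 1 := Complex.norm_eq_one_of_pow_eq_one hz (Nat.succ_ne_zero N)
  let J := complexEval ev (kerSub z T) (fun f hf => (hker z hz f hf).1)
    (fun f hf => (hker z hz f hf).2)
  let J' := complexEval ev (kerSub (z ^ n) T) (fun f hf => (hker _ hzn f hf).1)
    (fun f hf => (hker _ hzn f hf).2)
  refine edim_le_of_comp_mem J J' ?_ (phasePow n) (phasePow_zero n) (phasePow_one n) fun f => ?_
  · intro f g hfg
    have h1 : reFun K f = reFun K g := congrArg Subtype.val <|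
      hevinj ⟨_, (hker z hz f f.2).1⟩ ⟨_, (hker z hz g g.2).1⟩
        (funext fun φ => congrArg Complex.re (congrFun hfg φ))
    have h2 : imFun K f = imFun K g := congrArg Subtype.val <|
      hevinj ⟨_, (hker z hz f f.2).2⟩ ⟨_, (hker z hz g g.2).2⟩
        (funext fun φ => congrArg Complex.im (congrFun hfg φ))
    exact Subtype.ext (ContinuousMap.ext fun x =>
      Complex.ext (DFunLike.congr_fun h1 x) (DFunLike.congr_fun h2 x))
  · have hJΦ : ∀ φ, J f (Φ φ) = z * J f φ := fun φ => by
      have hTf := mem_kerSub.mp f.2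
      have h1 : R ⟨_, (hker z hz f f.2).1⟩ = ⟨reFun K (z • f), (hker z hz _ (z • f).2).1⟩ :=
        Subtype.ext (by
          rw [hRcoe, ← (hT.reFun_map _).1, hTf])
      have h2 : R ⟨_, (hker z hz f f.2).2⟩ = ⟨imFun K (z • f), (hker z hz _ (z • f).2).2⟩ :=
        Subtype.ext (by
          rw [hRcoe, ← (hT.reFun_map _).2, hTf])
      have h3 : J (z • f) φ = z * J f φ := by
        rw [map_smul]
        rfl
      rw [← h3]
      refine Complex.ext ?_ ?_
      · exact (hevR _ φ).symm.trans (congrFun (congrArg ev h1) φ)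
      · exact (hevR _ φ).symm.trans (congrFun (congrArg ev h2) φ)
    have hJc : Continuous (J f) := by
      have : J f = fun φ => ((latticeEval F e ⟨_, (hker z hz f f.2).1⟩ φ : ℝ) : ℂ) +
          (latticeEval F e ⟨_, (hker z hz f f.2).2⟩ φ : ℝ) * Complex.I :=
        funext fun φ => Complex.mk_eq_add_mul_I _ _
      rw [this]
      fun_prop
    have hgc : Continuous (phasePow n ∘ J f) := (continuous_phasePow n).comp hJc
    obtain ⟨a, ha⟩ := latticeEval_surjective he hF hcl
      ⟨fun φ => (phasePow n (J f φ)).re, Complex.continuous_re.comp hgc⟩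
    obtain ⟨b, hb⟩ := latticeEval_surjective he hF hcl
      ⟨fun φ => (phasePow n (J f φ)).im, Complex.continuous_im.comp hgc⟩
    have ha' : ∀ φ, ev a φ = (phasePow n (J f φ)).re := fun φ => DFunLike.congr_fun ha φ
    have hb' : ∀ φ, ev b φ = (phasePow n (J f φ)).im := fun φ => DFunLike.congr_fun hb φ
    let g : C(K, ℂ) := complexify K a + Complex.I • complexify K b
    have hgr : reFun K g = a := ContinuousMap.ext fun x => by simp [g]
    have hgi : imFun K g = b := ContinuousMap.ext fun x => by simp [g]
    have hΦ : ∀ φ, phasePow n (J f (Φ φ)) = z ^ n * phasePow n (J f φ) := fun φ => by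
      rw [hJΦ, phasePow_mul n hnorm]
    -- The eigenvalue equation for a + i b is checked on lattice states, which separate F.
    have hRa : R a = (z ^ n).re • a - (z ^ n).im • b := hevinj _ _ (funext fun φ => by
      rw [hevR, ha', hΦ, Complex.mul_re, map_sub, map_smul, map_smul, ← ha', ← hb']
      rfl)
    have hRb : R b = (z ^ n).re • b + (z ^ n).im • a := hevinj _ _ (funext fun φ => by
      rw [hevR, hb', hΦ, Complex.mul_im, map_add, map_smul, map_smul, ← ha', ← hb']
      rfl)
    have hg : g ∈ kerSub (z ^ n) T := by
      rw [mem_kerSub]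
      have h1 : reFun K (T g) = (z ^ n).re • a - (z ^ n).im • b := by
        rw [(hT.reFun_map g).1, hgr, ← hRcoe, hRa]
        rfl
      have h2 : imFun K (T g) = (z ^ n).re • b + (z ^ n).im • a := by
        rw [(hT.reFun_map g).2, hgi, ← hRcoe, hRb]
        rfl
      rw [← hgr, ← hgi] at h1 h2
      refine ContinuousMap.ext fun x => Complex.ext ?_ ?_
      · exact (DFunLike.congr_fun h1 x).trans (Complex.mul_re (z ^ n) (g x)).symm
      · exact (DFunLike.congr_fun h2 x).trans (Complex.mul_im (z ^ n) (g x)).symm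
    refine ⟨⟨g, hg⟩, funext fun φ => Complex.ext ?_ ?_⟩
    · have : (⟨reFun K g, (hker _ hzn g hg).1⟩ : F) = a := Subtype.ext hgr
      exact (congrFun (congrArg ev this) φ).trans (ha' φ)
    · have : (⟨imFun K g, (hker _ hzn g hg).2⟩ : F) = b := Subtype.ext hgi
      exact (congrFun (congrArg ev this) φ).trans (hb' φ)

/-! ### Point spectrum and spectral radius -/

theorem edim_pos_iff {V : Type*} [AddCommGroup V] [Module ℂ V] :
    1 ≤ edim V ↔ ∃ v : V, v ≠ 0 := by
  rw [edim, ← Nat.cast_one, Cardinal.natCast_le_toENat, Nat.cast_one, Cardinal.one_le_iff_pos,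
    rank_pos_iff_exists_ne_zero]

theorem mem_pointSpectrum_iff {X : Type*} [NormedAddCommGroup X] [NormedSpace ℂ X] {z : ℂ}
    {T : X →L[ℂ] X} : z ∈ pointSpectrum T ↔ 1 ≤ edim (kerSub z T) := by
  rw [edim_pos_iff]
  constructor
  · rintro ⟨x, hx, hTx⟩
    exact ⟨⟨x, mem_kerSub.mpr hTx⟩, fun h => hx (congrArg Subtype.val h)⟩
  · rintro ⟨x, hx⟩
    exact ⟨x, fun h => hx (Subtype.ext h), mem_kerSub.mp x.2⟩

theorem IsMarkovOperator.spectralRadius_eq_one [Nonempty K] {T : C(K, ℂ) →L[ℂ] C(K, ℂ)}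
    (hT : IsMarkovOperator T) : spectralRadius ℂ T = 1 := by
  refine le_antisymm ?_ ?_
  · refine (spectrum.spectralRadius_le_nnnorm T).trans ?_
    rw [← ENNReal.coe_one, ENNReal.coe_le_coe, ← NNReal.coe_le_coe]
    exact hT.norm_le_one
  · have h1 : (1 : ℂ) ∈ spectrum ℂ T := by
      rw [spectrum.mem_iff, Algebra.algebraMap_eq_smul_one, one_smul]
      intro h
      obtain ⟨u, hu⟩ := h
      have h2 : (↑u⁻¹ * (1 - T)) 1 = (1 : C(K, ℂ)) := by
        rw [← hu, Units.inv_mul]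
        rfl
      have h3 : (1 - T) 1 = 0 := by
        change (1 : C(K, ℂ)) - T 1 = 0
        rw [hT.map_one, sub_self]
      rw [mul_apply_eq_comp, h3, map_zero] at h2
      exact zero_ne_one h2
    have := le_iSup₂ (f := fun (k : ℂ) (_ : k ∈ spectrum ℂ T) => (‖k‖₊ : ENNReal)) 1 h1
    simpa [spectralRadius] using this

end Markov

theorem mainTheorem10 {K : Type*} [TopologicalSpace K] [CompactSpace K] [T2Space K]
    (hK : IsOrderComplete C(K, ℝ))
    (T : C(K, ℂ) →L[ℂ] C(K, ℂ)) (hT : IsMarkovOperator T) :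
    (∀ θ : ℝ, (∃ q : ℚ, θ = 2 * Real.pi * (q : ℝ)) → ∀ n : ℤ,
      edim (kerSub (Complex.exp (Complex.I * (θ : ℂ))) T) ≤
        edim (kerSub (Complex.exp (Complex.I * (n : ℂ) * (θ : ℂ))) T)) ∧
    IsCyclicSet (rationalPeripheralPointSpectrum T) := by
  have hpow : ∀ (θ : ℝ) (n : ℤ), Complex.exp (Complex.I * (n : ℂ) * (θ : ℂ)) =
      Complex.exp (Complex.I * (θ : ℂ)) ^ n := fun θ n => by
    rw [← Complex.exp_int_mul]
    congr 1
    ring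
  have hdim : ∀ θ : ℝ, (∃ q : ℚ, θ = 2 * Real.pi * (q : ℝ)) → ∀ n : ℤ,
      edim (kerSub (Complex.exp (Complex.I * (θ : ℂ))) T) ≤
        edim (kerSub (Complex.exp (Complex.I * (n : ℂ) * (θ : ℂ))) T) := by
    rintro θ ⟨q, rfl⟩ n
    rw [hpow]
    -- The denominator q.den is a period of the root of unity, and it is written as N + 1.
    refine hT.edim_kerSub_le hK (N := q.den - 1) ?_ n
    rw [Nat.sub_add_cancel q.pos, ← Complex.exp_nat_mul, Complex.exp_eq_one_iff]
    refine ⟨q.num, ?_⟩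
    have hq : (q : ℂ) * q.den = q.num := by exact_mod_cast Rat.mul_den_eq_num q
    push_cast
    rw [← hq]
    ring
  refine ⟨hdim, fun r θ hr hmem n => ?_⟩
  obtain ⟨⟨q, hq⟩, hp⟩ := hmem
  -- On an empty K the zero space has no eigenvectors; otherwise the spectral radius is 1.
  have hne : Nonempty K := by
    obtain ⟨f, hf, -⟩ := hp
    by_contra hemp
    rw [not_nonempty_iff] at hemp
    exact hf (ContinuousMap.ext fun x => hemp.elim x)
  have hexp : ∀ t : ℝ, ‖Complex.exp (Complex.I * (t : ℂ))‖ = 1 := fun t => by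
    rw [mul_comm]
    exact Complex.norm_exp_ofReal_mul_I t
  rw [hT.spectralRadius_eq_one, ENNReal.toReal_one, Complex.ofReal_one, one_mul] at hq
  have hr1 : r = 1 := by
    have := congrArg norm hq
    rwa [norm_mul, hexp, hexp, mul_one, Complex.norm_real, Real.norm_of_nonneg hr] at this
  rw [hr1, Complex.ofReal_one, one_mul] at hq hp
  -- θ agrees with 2πq only modulo 2π, so the angle is exchanged inside an integer power.
  rw [hr1, Complex.ofReal_one, one_mul, hpow, hq, ← hpow]
  refine ⟨⟨n * q, ?_⟩, ?_⟩
  · rw [hT.spectralRadius_eq_one, ENNReal.toReal_one, Complex.ofReal_one, one_mul]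
    congr 1
    push_cast
    ring
  · rw [hq] at hp
    rw [mem_pointSpectrum_iff] at hp ⊢
    exact hp.trans (hdim _ ⟨q, rfl⟩ n)
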